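/- Let $N\ge 2$ and let $\mathbb B_N$ be the open unit ball of $\mathbb C^N$ (for the Euclidean norm $|\cdot|$). There is a holomorphic function $f\colon\mathbb B_N\to\mathbb C$ such that $\operatorname{Re} f$ is unbounded on every path of finite length that ends on the sphere $b\mathbb B_N$. That is: if $p\colon[0,1]\to\overline{\mathbb B_N}$ is a continuous path of finite length with $|p(t)|<1$ for $0\le t<1$ and $|p(1)|=1$, then the function $t\mapsto \operatorname{Re} f(p(t))$ is unbounded on $[0,1)$. -/

import Mathlib

/-- `p : [0,1] → E` is a path of finite length that ends on the unit sphere and otherwise runs in the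
open unit ball: it is continuous on `[0,1]`, its length (the supremum of the lengths of the inscribed
polygons, i.e. its total variation) is finite, `‖p t‖ < 1` for `0 ≤ t < 1`, and `‖p 1‖ = 1`.
The values of `p` outside `[0,1]` play no role. -/
structure IsFiniteLengthPathToSphere {E : Type*} [NormedAddCommGroup E] (p : ℝ → E) : Prop where
  continuousOn : ContinuousOn p (Set.Icc 0 1)
  length_ne_top : eVariationOn p (Set.Icc 0 1) ≠ ⊤
  norm_lt_one : ∀ t ∈ Set.Ico (0 : ℝ) 1, ‖p t‖ < 1
  norm_end : ‖p 1‖ = 1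

/-! Spheres of radius `ρ k` increase to the unit sphere with gaps of order `1/k²`. A cap of size `s`
is cut off by a complex-linear functional at depth of order `s²`, so a gap of that order leaves room
for caps of size about `1/k`. `exists_entire_small_on_ball_large_on_caps` gives an entire function
small on one ball and large on separated caps of the next sphere; summing with corrections
(`exists_differentiableOn_ball_re_ge`) makes `Re f` tend to infinity along the caps.

The spheres come in blocks of `m`, with `m` independent of the scale; in each block the half-size
caps cover all directions (`exists_separated_covering_families`). If `Re f` is bounded on a path,
its crossings eventually avoid the caps. The direction at the start of a block lies in some
half-size cap, so it must move by at least `s` within the block. These moves sum like the harmonic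
series, so the length is infinite. -/

/-! ### Runge approximation on a slit disc. -/

/-- The closed unit disc with the open vertical strip `α < re z < β` removed. -/
def slitDisc (α β : ℝ) : Set ℂ := {z | ‖z‖ ≤ 1 ∧ (z.re ≤ α ∨ β ≤ z.re)}

theorem isCompact_slitDisc (α β : ℝ) : IsCompact (slitDisc α β) := by
  refine (isCompact_closedBall (0 : ℂ) 1).of_isClosed_subset ?_ fun z hz => by simpa using hz.1
  exact (isClosed_le continuous_norm continuous_const).inter
    ((isClosed_le Complex.continuous_re continuous_const).union
      (isClosed_le continuous_const Complex.continuous_re))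

/-- The complement of a slit disc has no bounded components. -/
theorem not_isBounded_connectedComponentIn_compl_slitDisc {α β : ℝ} {w : ℂ}
    (hw : w ∉ slitDisc α β) :
    ¬ Bornology.IsBounded (connectedComponentIn (slitDisc α β)ᶜ w) := by
  -- Escape radially from outside the disc, vertically from inside the strip.
  obtain ⟨v, hv, hray⟩ : ∃ v : ℂ, v ≠ 0 ∧ ∀ t : ℝ, 0 ≤ t → w + t * v ∉ slitDisc α β := by
    by_cases h1 : 1 < ‖w‖
    · refine ⟨w, fun h => by simp [h] at h1; linarith, fun t ht h => ?_⟩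
      have h2 : ‖w + t * w‖ = (1 + t) * ‖w‖ := by
        rw [show w + t * w = ((1 + t : ℝ) : ℂ) * w by push_cast; ring, norm_mul,
          Complex.norm_real, Real.norm_of_nonneg (by linarith)]
      have := h.1
      nlinarith
    · refine ⟨Complex.I, Complex.I_ne_zero, fun t _ h => hw ⟨not_lt.mp h1, ?_⟩⟩
      simpa using h.2
  have hconn : IsPreconnected ((fun t : ℝ => w + t * v) '' Set.Ici 0) :=
    isPreconnected_Ici.image _ (by fun_prop)
  have hsub : (fun t : ℝ => w + t * v) '' Set.Ici 0 ⊆ connectedComponentIn (slitDisc α β)ᶜ w :=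
    hconn.subset_connectedComponentIn ⟨0, by simp, by simp⟩
      (by rintro _ ⟨t, ht, rfl⟩; exact hray t ht)
  intro hb
  obtain ⟨C, hC⟩ := (hb.subset hsub).exists_norm_le
  have hvpos : 0 < ‖v‖ := norm_pos_iff.mpr hv
  have hCw : 0 ≤ C := (norm_nonneg _).trans (hC _ ⟨0, by simp, rfl⟩)
  set t : ℝ := (C + ‖w‖ + 1) / ‖v‖ with ht
  have ht0 : 0 ≤ t := by positivity
  have h1 := hC _ ⟨t, ht0, rfl⟩
  have h2 : ‖(t : ℂ) * v‖ = C + ‖w‖ + 1 := by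
    rw [norm_mul, Complex.norm_real, Real.norm_of_nonneg ht0, ht]
    field_simp
  have h3 : ‖(t : ℂ) * v‖ ≤ ‖w + t * v‖ + ‖w‖ := by
    simpa using norm_sub_le (w + t * v) w
  simp only at h1
  linarith

/-- A large circle that separates the two halves of a slit disc. -/
theorem exists_circle_separating_slitDisc {α β : ℝ} (h : α < β) :
    ∃ c : ℂ, ∃ r : ℝ, 0 < r ∧ (∀ z : ℂ, ‖z‖ ≤ 1 → z.re ≤ α → r < ‖z - c‖) ∧
      ∀ z : ℂ, ‖z‖ ≤ 1 → β ≤ z.re → ‖z - c‖ < r := by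
  set μ := (α + β) / 2 with hμ
  -- The circle about `T` through `μ` is nearly vertical over the disc: the last summand of `T`
  -- yields `(T - μ)² - (T - β)² > 1 ≥ (im z)²`.
  obtain ⟨T, hT⟩ : ∃ T : ℝ, T = 1 + |α| + |β| + 1 / (β - μ) := ⟨_, rfl⟩
  have hβμ : 0 < β - μ := by linarith
  have hinv : 0 < 1 / (β - μ) := by positivity
  have ha := neg_abs_le α
  have ha' := le_abs_self α
  have hb := neg_abs_le β
  have hb' := le_abs_self β
  refine ⟨T, T - μ, by linarith, fun z _ hz => ?_, fun z hz1 hz => ?_⟩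
  · have := Complex.abs_re_le_norm (z - T)
    have h2 := neg_abs_le (z - T).re
    simp at h2 this
    linarith
  · have hsq : ‖z - T‖ ^ 2 = (T - z.re) ^ 2 + z.im ^ 2 := by
      rw [Complex.sq_norm, Complex.normSq_apply]; simp; ring
    have hz2 : z.re ^ 2 + z.im ^ 2 ≤ 1 := by
      have : ‖z‖ ^ 2 = z.re ^ 2 + z.im ^ 2 := by
        rw [Complex.sq_norm, Complex.normSq_apply]; ring
      rw [← this]
      exact pow_le_one₀ (norm_nonneg _) hz1
    have hre : z.re ≤ 1 := (Complex.re_le_norm z).trans hz1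
    have h3 : (T - z.re) ^ 2 ≤ (T - β) ^ 2 := by
      apply pow_le_pow_left₀ <;> linarith
    have h4 : 1 < (β - μ) * (2 * T - β - μ) := by
      have : (β - μ) * (1 / (β - μ)) = 1 := by field_simp
      have h6 : 1 / (β - μ) < 2 * T - β - μ := by linarith
      nlinarith
    refine lt_of_pow_lt_pow_left₀ 2 (by linarith) ?_
    rw [hsq]
    nlinarith

/-- Runge approximation of the indicator function of one half of a slit disc. -/
theorem exists_entire_approx_step {α β ε : ℝ} (h : α < β) (hε : 0 < ε) :
    ∃ G : ℂ → ℂ, Differentiable ℂ G ∧ (∀ z : ℂ, ‖z‖ ≤ 1 → z.re ≤ α → ‖G z‖ < ε) ∧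
      ∀ z : ℂ, ‖z‖ ≤ 1 → β ≤ z.re → ‖G z - 1‖ < ε := by
  obtain ⟨c, r, hr, hout, hin⟩ := exists_circle_separating_slitDisc h
  set K := slitDisc α β with hK
  have : CompactSpace K := isCompact_iff_compactSpace.mp (isCompact_slitDisc α β)
  let S : Subalgebra ℂ C(K, ℂ) := (polynomialFunctions K).topologicalClosure
  have hS : IsClosed (S : Set C(K, ℂ)) := Subalgebra.isClosed_topologicalClosure _
  have : CompleteSpace S := hS.completeSpace_coe
  let x : S := ⟨Polynomial.toContinuousMapOn Polynomial.X K,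
    Subalgebra.le_topologicalClosure _ ⟨Polynomial.X, trivial, rfl⟩⟩
  have hxK : spectrum ℂ (x : C(K, ℂ)) = K := by
    rw [ContinuousMap.spectrum_eq_range]
    ext z
    simp [x]
  -- Passing to a closed subalgebra can only fill bounded components of the complement of the
  -- spectrum, and `Kᶜ` has none.
  have hspec : ∀ w ∉ K, w ∈ resolventSet ℂ x := by
    intro w hw
    by_contra hcon
    have := Subalgebra.spectrum_isBounded_connectedComponentIn S x hcon
    rw [hxK] at this
    exact not_isBounded_connectedComponentIn_compl_slitDisc hw this
  have hsphere : ∀ w ∈ Metric.sphere c r, w ∉ K := by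
    rintro w hw ⟨h1, h2 | h2⟩ <;> rw [mem_sphere_iff_norm] at hw
    · exact (hout w h1 h2).ne' hw
    · exact (hin w h1 h2).ne hw
  have hcont : ContinuousOn (resolvent x) (Metric.sphere c r) := fun w hw =>
    (spectrum.hasDerivAt_resolvent_const_left
      (hspec w (hsphere w hw))).continuousAt.continuousWithinAt
  have heval : ∀ (z : K) (w : ℂ), w ∉ K → ((resolvent x w : S) : C(K, ℂ)) z = (w - z)⁻¹ := by
    intro z w hw
    have h1 : resolvent x w * (algebraMap ℂ S w - x) = 1 := Ring.inverse_mul_cancel _ (hspec w hw)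
    have h2 := congrArg (fun y : S => (y : C(K, ℂ)) z) h1
    simp [x] at h2
    exact eq_inv_of_mul_eq_one_left h2
  -- The Riesz idempotent: its value at `z` is the winding number of the circle about `z`, and as an
  -- element of `S` it is a limit of polynomials.
  let e : S := (2 * Real.pi * Complex.I : ℂ)⁻¹ • ∮ w in C(c, r), resolvent x w
  have he : ∀ z : K, (e : C(K, ℂ)) z =
      (2 * Real.pi * Complex.I : ℂ)⁻¹ • ∮ w in C(c, r), (w - z)⁻¹ := by
    intro z
    let L : S →L[ℂ] ℂ := (ContinuousMap.evalCLM ℂ z).comp S.toSubmodule.subtypeL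
    have hL : ∀ y : S, L y = (y : C(K, ℂ)) z := fun y => rfl
    have hI : L (∮ w in C(c, r), resolvent x w) = ∮ w in C(c, r), (w - z)⁻¹ := by
      rw [circleIntegral, ← ContinuousLinearMap.intervalIntegral_comp_comm]
      · refine intervalIntegral.integral_congr fun θ _ => ?_
        exact congrArg (deriv (circleMap c r) θ • ·)
          (heval z _ (hsphere _ (circleMap_mem_sphere c hr.le θ)))
      · exact (hcont.circleIntegrable hr.le).out
    rw [← hL, ← hI, ← map_smul]
  have hmem : (e : C(K, ℂ)) ∈ closure (polynomialFunctions K : Set C(K, ℂ)) := e.2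
  obtain ⟨_, ⟨P, -, rfl⟩, hP⟩ := Metric.mem_closure_iff.mp hmem ε hε
  have happ : ∀ z (hz : z ∈ K), ‖P.eval z - (e : C(K, ℂ)) ⟨z, hz⟩‖ < ε := by
    intro z hz
    have := (ContinuousMap.dist_lt_iff hε).mp hP ⟨z, hz⟩
    rw [dist_comm, dist_eq_norm] at this
    simpa using this
  refine ⟨fun z => P.eval z, P.differentiable, fun z h1 h2 => ?_, fun z h1 h2 => ?_⟩
  · have h3 := happ z ⟨h1, Or.inl h2⟩
    rw [he, DiffContOnCl.circleIntegral_eq_zero hr.le, smul_zero, sub_zero] at h3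
    · exact h3
    · refine DifferentiableOn.diffContOnCl_ball (U := {z}ᶜ) ?_ ?_
      · intro w hw
        exact ((differentiableAt_id.sub_const z).inv
          (sub_ne_zero.mpr hw)).differentiableWithinAt
      · rintro w hw rfl
        rw [mem_closedBall_iff_norm] at hw
        exact absurd (hout w h1 h2) hw.not_gt
  · have h3 := happ z ⟨h1, Or.inr h2⟩
    rw [he, circleIntegral.integral_sub_inv_of_mem_ball
      (by rw [mem_ball_iff_norm]; exact hin z h1 h2), smul_eq_mul,
      inv_mul_cancel₀ Complex.two_pi_I_ne_zero] at h3
    exact h3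

/-! ### Entire functions large on caps. -/

theorem re_inner_of_norm_eq_one {E : Type*} [NormedAddCommGroup E] [InnerProductSpace ℂ E]
    {a u : E} (ha : ‖a‖ = 1) (hu : ‖u‖ = 1) :
    (inner ℂ a u).re = 1 - dist u a ^ 2 / 2 := by
  have h := norm_sub_sq (𝕜 := ℂ) a u
  rw [ha, hu, ← dist_eq_norm, dist_comm] at h
  simp only [RCLike.re_to_complex] at h
  linarith

/-- For a separated set `A` of directions there is an entire function that is small on a ball and
has large real part on the caps around `A` of a slightly larger sphere. -/
theorem exists_entire_small_on_ball_large_on_caps {E : Type*} [NormedAddCommGroup E]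
    [InnerProductSpace ℂ E] {A : Finset E} {s ρ ρ' : ℝ} (hs : 0 < s) (hA1 : ∀ a ∈ A, ‖a‖ = 1)
    (hA : ∀ a ∈ A, ∀ b ∈ A, a ≠ b → 5 * s ≤ dist a b) (hρ : 0 ≤ ρ) (hρ' : ρ' ≤ 1)
    (hgap : ρ + 3 * s ^ 2 ≤ ρ') {ε : ℝ} (hε : 0 < ε) (M : ℝ) :
    ∃ g : E → ℂ, Differentiable ℂ g ∧ (∀ z, ‖z‖ ≤ ρ → ‖g z‖ ≤ ε) ∧
      ∀ u : E, ‖u‖ = 1 → (∃ a ∈ A, dist u a ≤ 2 * s) → M ≤ (g ((ρ' : ℂ) • u)).re := by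
  classical
  have hs2 : 0 < s ^ 2 := by positivity
  have hρ'0 : 0 < ρ' := by linarith
  -- Under `inner ℂ a`, points of the sphere within `2 * s` of the direction `a` have real part at
  -- least `ρ' * (1 - 2 * s ^ 2)`; the inner ball and the directions at distance at least `3 * s`
  -- stay left of `α`.
  set α := max ρ (ρ' * (1 - 9 / 2 * s ^ 2)) with hα
  have hαβ : α < ρ' * (1 - 2 * s ^ 2) := by
    apply max_lt <;> nlinarith
  -- The sum of the approximate indicators has real part at least `1/2` on the caps, hence the
  -- factor `2`.
  set m : ℝ := 2 * (|M| + 1) with hm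
  have hm0 : 0 < m := by positivity
  set n : ℝ := (A.card : ℝ) with hn
  have hn0 : 0 ≤ n := Nat.cast_nonneg _
  set δ : ℝ := min (1 / (2 * (n + 1))) (ε / (m * (n + 1))) with hδ
  have hδ0 : 0 < δ := by positivity
  have hδ1 : n * δ ≤ 1 / 2 := by
    have : δ * (2 * (n + 1)) ≤ 1 := (le_div_iff₀ (by positivity)).mp (min_le_left _ _)
    nlinarith
  have hδ2 : m * (n * δ) ≤ ε := by
    have : δ * (m * (n + 1)) ≤ ε := (le_div_iff₀ (by positivity)).mp (min_le_right _ _)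
    nlinarith [mul_pos hm0 hδ0]
  obtain ⟨G, hG, hG0, hG1⟩ := exists_entire_approx_step hαβ hδ0
  refine ⟨fun z => m * ∑ a ∈ A, G (inner ℂ a z), ?_, fun z hz => ?_, ?_⟩
  · refine (Differentiable.fun_sum fun a _ => ?_).const_mul _
    exact hG.comp (innerSL ℂ a).differentiable
  · rw [norm_mul, Complex.norm_real, Real.norm_of_nonneg hm0.le]
    refine le_trans ?_ hδ2
    gcongr
    refine (norm_sum_le_of_le A (n := fun _ => δ) fun a ha => ?_).trans_eq (by simp [hn])
    have h1 : ‖inner ℂ a z‖ ≤ ρ := (norm_inner_le_norm a z).trans (by rw [hA1 a ha]; linarith)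
    exact (hG0 _ (by linarith) (((Complex.re_le_norm _).trans h1).trans (le_max_left _ _))).le
  · rintro u hu ⟨a, ha, hau⟩
    have hn1 : ∀ b ∈ A, ‖inner ℂ b ((ρ' : ℂ) • u)‖ ≤ 1 := fun b hb =>
      (norm_inner_le_norm _ _).trans (by
        rw [hA1 b hb, norm_smul, hu, Complex.norm_real, Real.norm_of_nonneg hρ'0.le]; linarith)
    have hre : ∀ b ∈ A, (inner ℂ b ((ρ' : ℂ) • u)).re = ρ' * (1 - dist u b ^ 2 / 2) := by
      intro b hb
      rw [inner_smul_right, Complex.re_ofReal_mul, re_inner_of_norm_eq_one (hA1 b hb) hu]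
    have hmain : ‖G (inner ℂ a ((ρ' : ℂ) • u)) - 1‖ < δ := by
      apply hG1 _ (hn1 a ha)
      rw [hre a ha]
      have : dist u a ^ 2 ≤ (2 * s) ^ 2 := pow_le_pow_left₀ dist_nonneg hau 2
      nlinarith
    have hother : ∀ b ∈ A.erase a, ‖G (inner ℂ b ((ρ' : ℂ) • u))‖ ≤ δ := by
      intro b hb
      obtain ⟨hba, hb⟩ := Finset.mem_erase.mp hb
      refine (hG0 _ (hn1 b hb) (le_trans ?_ (le_max_right _ _))).le
      rw [hre b hb]
      have h1 := hA a ha b hb hba.symm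
      have h2 := dist_triangle_left a b u
      have : (3 * s) ^ 2 ≤ dist u b ^ 2 := pow_le_pow_left₀ (by positivity) (by linarith) 2
      nlinarith
    have hsum : ‖∑ b ∈ A, G (inner ℂ b ((ρ' : ℂ) • u)) - 1‖ ≤ n * δ := by
      rw [← Finset.add_sum_erase A _ ha, add_sub_right_comm]
      have h1 := norm_add_le (G (inner ℂ a ((ρ' : ℂ) • u)) - 1)
        (∑ b ∈ A.erase a, G (inner ℂ b ((ρ' : ℂ) • u)))
      have h2 := norm_sum_le_of_le (A.erase a) (n := fun _ => δ) hother
      have h3 : ∑ _b ∈ A.erase a, δ = (n - 1) * δ := by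
        rw [Finset.sum_const, Finset.card_erase_of_mem ha, nsmul_eq_mul,
          Nat.cast_sub (Finset.card_pos.mpr ⟨a, ha⟩), Nat.cast_one]
      linarith
    rw [Complex.re_ofReal_mul]
    have h4 := (Complex.abs_re_le_norm _).trans (hsum.trans hδ1)
    rw [Complex.sub_re, Complex.one_re, abs_le] at h4
    have := le_abs_self M
    nlinarith [h4.1]

/-! ### Summation in the ball. -/

/-- A sum of entire functions which are geometrically small on an exhaustion of the unit ball is
holomorphic in the unit ball. -/
theorem differentiableOn_tsum_of_exhaustion {E : Type*} [NormedAddCommGroup E] [NormedSpace ℂ E]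
    {ρ : ℕ → ℝ} (hmono : Monotone ρ) (hlim : Filter.Tendsto ρ Filter.atTop (nhds 1))
    {h : ℕ → E → ℂ} (hd : ∀ k, Differentiable ℂ (h k))
    (hb : ∀ k z, ‖z‖ ≤ ρ k → ‖h k z‖ ≤ (1 / 2) ^ k) :
    DifferentiableOn ℂ (fun z => ∑' k, h k z) (Metric.ball 0 1) := by
  intro x hx
  rw [mem_ball_zero_iff] at hx
  obtain ⟨R, hxR, hR1⟩ := exists_between hx
  obtain ⟨R', hRR', hR'1⟩ := exists_between hR1
  obtain ⟨n₀, hn₀⟩ := (hlim.eventually_const_lt hR'1).exists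
  have hρ : ∀ n, R' < ρ (n + n₀) := fun n => hn₀.trans_le (hmono (Nat.le_add_left _ _))
  have hsum : Summable fun n : ℕ => (1 / 2 : ℝ) ^ (n + n₀) :=
    (summable_nat_add_iff n₀).mpr (summable_geometric_of_lt_one (by norm_num) (by norm_num))
  have hsz : ∀ z : E, ‖z‖ < R' → Summable fun n => h (n + n₀) z := fun z hz =>
    hsum.of_norm_bounded fun n => hb _ z (hz.trans (hρ n)).le
  have hderiv : ∀ n, ∀ y ∈ Metric.ball (0 : E) R,
      ‖fderiv ℂ (h (n + n₀)) y‖ ≤ 2 / (R' - R) * (1 / 2) ^ (n + n₀) := by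
    intro n y hy
    rw [mem_ball_zero_iff] at hy
    have hbd : ∀ w ∈ Metric.ball y (R' - R), ‖h (n + n₀) w‖ ≤ (1 / 2) ^ (n + n₀) := by
      intro w hw
      rw [mem_ball_iff_norm] at hw
      apply hb
      have := norm_le_norm_add_norm_sub y w
      rw [norm_sub_rev] at this
      linarith [hρ n]
    have hmaps : Set.MapsTo (h (n + n₀)) (Metric.ball y (R' - R))
        (Metric.closedBall (h (n + n₀) y) (2 * (1 / 2) ^ (n + n₀))) := by
      intro w hw
      rw [mem_closedBall_iff_norm]
      have h1 := hbd w hw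
      have h2 := hbd y (Metric.mem_ball_self (by linarith))
      have := norm_sub_le (h (n + n₀) w) (h (n + n₀) y)
      linarith
    have := Complex.norm_fderiv_le_div_of_mapsTo_ball (hd _).differentiableOn hmaps
      (by linarith)
    exact this.trans_eq (by ring)
  let : NormedSpace ℝ E := NormedSpace.restrictScalars ℝ ℂ E
  have htail : DifferentiableAt ℂ (fun z => ∑' n, h (n + n₀) z) x := by
    refine (hasFDerivAt_tsum_of_isPreconnected (hsum.mul_left (2 / (R' - R)))
      (s := Metric.ball 0 R) Metric.isOpen_ball
      (convex_ball _ _).isPreconnected (fun n y _ => (hd _ y).hasFDerivAt) hderiv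
      (x₀ := x) (by simpa using hxR) (hsz x (hxR.trans hRR')) (by simpa using hxR)).differentiableAt
  have heq : (fun z => ∑' k, h k z) =ᶠ[nhds x]
      fun z => ∑ k ∈ Finset.range n₀, h k z + ∑' n, h (n + n₀) z := by
    filter_upwards [Metric.isOpen_ball.mem_nhds (show x ∈ Metric.ball 0 R by simpa using hxR)]
      with z hz
    rw [mem_ball_zero_iff] at hz
    exact (((summable_nat_add_iff n₀).mp (hsz z (hz.trans hRR'))).sum_add_tsum_nat_add n₀).symm
  refine (heq.differentiableAt_iff.mpr ?_).differentiableWithinAt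
  exact (DifferentiableAt.fun_sum fun k _ => hd k x).add htail

/-- If on each set `B k` one can make the real part of an entire function arbitrarily large while
keeping it small on the `k`-th ball of an exhaustion, then some function holomorphic in the unit
ball has real part at least `k` on `B k` for all `k`. -/
theorem exists_differentiableOn_ball_re_ge {E : Type*} [NormedAddCommGroup E] [NormedSpace ℂ E]
    [FiniteDimensional ℂ E] {ρ : ℕ → ℝ} (hmono : Monotone ρ)
    (hlim : Filter.Tendsto ρ Filter.atTop (nhds 1)) {B : ℕ → Set E}
    (hB : ∀ k, ∀ z ∈ B k, ‖z‖ ≤ ρ (k + 1))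
    (hg : ∀ k, ∀ ε : ℝ, 0 < ε → ∀ M : ℝ, ∃ g : E → ℂ, Differentiable ℂ g ∧
      (∀ z, ‖z‖ ≤ ρ k → ‖g z‖ ≤ ε) ∧ ∀ z ∈ B k, M ≤ (g z).re) :
    ∃ f : E → ℂ, DifferentiableOn ℂ f (Metric.ball 0 1) ∧ ∀ k : ℕ, ∀ z ∈ B k, k ≤ (f z).re := by
  have : ProperSpace E := FiniteDimensional.proper ℂ E
  have hstep : ∀ (k : ℕ) (F : {F : E → ℂ // Differentiable ℂ F}),
      ∃ F' : {F : E → ℂ // Differentiable ℂ F},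
        (∀ z, ‖z‖ ≤ ρ k → ‖F'.1 z - F.1 z‖ ≤ (1 / 2) ^ k) ∧ ∀ z ∈ B k, k + 2 ≤ (F'.1 z).re := by
    rintro k ⟨F, hF⟩
    obtain ⟨C, hC⟩ := (isCompact_closedBall (0 : E) (ρ (k + 1))).exists_bound_of_continuousOn
      hF.continuous.continuousOn
    -- `C` outweighs the earlier terms; the surplus `2` absorbs all later ones, whose sum is at most
    -- `(1 / 2) ^ k`.
    obtain ⟨g, hgd, hgs, hgl⟩ := hg k ((1 / 2) ^ k) (by positivity) (k + 2 + C)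
    refine ⟨⟨fun z => F z + g z, hF.add hgd⟩, fun z hz => by simpa using hgs z hz, fun z hz => ?_⟩
    have h1 := hC z (by simpa using hB k z hz)
    have h2 := abs_le.mp ((Complex.abs_re_le_norm (F z)).trans h1)
    have h3 := hgl z hz
    simp only [Complex.add_re]
    linarith [h2.1]
  choose next hnext hlarge using hstep
  let F : ℕ → {F : E → ℂ // Differentiable ℂ F} :=
    Nat.rec ⟨fun _ => 0, differentiable_const 0⟩ next
  let h : ℕ → E → ℂ := fun k z => (F (k + 1)).1 z - (F k).1 z
  have hb : ∀ k z, ‖z‖ ≤ ρ k → ‖h k z‖ ≤ (1 / 2) ^ k := fun k => hnext k (F k)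
  have hsumF : ∀ n z, ∑ k ∈ Finset.range n, h k z = (F n).1 z := by
    intro n z
    rw [Finset.sum_range_sub fun k => (F k).1 z]
    exact sub_zero _
  refine ⟨fun z => ∑' k, h k z, differentiableOn_tsum_of_exhaustion hmono hlim
    (fun k => (F (k + 1)).2.sub (F k).2) hb, fun k z hz => ?_⟩
  have hgeo : HasSum (fun n : ℕ => (1 / 2 : ℝ) ^ (n + (k + 1))) ((1 / 2) ^ k) := by
    have := hasSum_geometric_two.mul_right ((1 / 2 : ℝ) ^ (k + 1))
    simp only [← pow_add] at this
    rwa [show 2 * (1 / 2 : ℝ) ^ (k + 1) = (1 / 2) ^ k by rw [pow_succ]; ring] at this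
  have hbz : ∀ n, ‖h (n + (k + 1)) z‖ ≤ (1 / 2) ^ (n + (k + 1)) := fun n =>
    hb _ z ((hB k z hz).trans (hmono (Nat.le_add_left _ _)))
  have htail := tsum_of_norm_bounded hgeo hbz
  have hs : Summable fun n => h n z :=
    (summable_nat_add_iff (k + 1)).mp (hgeo.summable.of_norm_bounded hbz)
  beta_reduce
  rw [← hs.sum_add_tsum_nat_add (k + 1), hsumF, Complex.add_re]
  have h1 := abs_le.mp ((Complex.abs_re_le_norm _).trans htail)
  have h2 : (1 / 2 : ℝ) ^ k ≤ 1 := pow_le_one₀ (by norm_num) (by norm_num)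
  have h3 : (k : ℝ) + 2 ≤ ((F (k + 1)).1 z).re := hlarge k (F k) z hz
  linarith [h1.1]

/-! ### Packing and covering of the sphere. -/

/-- A totally bounded set contains a finite maximal `δ`-separated subset. -/
theorem TotallyBounded.exists_finset_maximal_separated {X : Type*} [PseudoMetricSpace X]
    {T : Set X} (hT : TotallyBounded T) {δ : ℝ} (hδ : 0 < δ) :
    ∃ A : Finset X, (∀ a ∈ A, a ∈ T) ∧ (∀ a ∈ A, ∀ b ∈ A, a ≠ b → δ ≤ dist a b) ∧
      ∀ u ∈ T, ∃ a ∈ A, dist u a < δ := by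
  classical
  obtain ⟨t, htf, ht⟩ := Metric.totallyBounded_iff.mp hT (δ / 2) (by linarith)
  have hcard : ∀ A : Finset X, (∀ a ∈ A, a ∈ T) → (∀ a ∈ A, ∀ b ∈ A, a ≠ b → δ ≤ dist a b) →
      A.card ≤ htf.toFinset.card := by
    intro A hAT hA
    have hcov : ∀ a ∈ A, ∃ c ∈ t, dist a c < δ / 2 := by
      intro a ha
      simpa using ht (hAT a ha)
    choose! c hct hc using hcov
    refine Finset.card_le_card_of_injOn c (fun a ha => by simpa using hct a ha) ?_
    intro a ha b hb hab
    by_contra hne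
    have h1 := hA a ha b hb hne
    have h2 := dist_triangle_right a b (c a)
    have h3 := hc a ha
    have h4 := hc b hb
    rw [← hab] at h4
    linarith
  by_contra! hcon
  have hgrow : ∀ n : ℕ, ∃ A : Finset X, A.card = n ∧ (∀ a ∈ A, a ∈ T) ∧
      ∀ a ∈ A, ∀ b ∈ A, a ≠ b → δ ≤ dist a b := by
    intro n
    induction n with
    | zero => exact ⟨∅, by simp⟩
    | succ n ih =>
      obtain ⟨A, hAn, hAT, hA⟩ := ih
      obtain ⟨u, hu, hfar⟩ := hcon A hAT hA
      have huA : u ∉ A := fun h => by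
        have := hfar u h
        rw [dist_self] at this
        linarith
      refine ⟨insert u A, by rw [Finset.card_insert_of_notMem huA, hAn], ?_, ?_⟩
      · simpa using ⟨hu, hAT⟩
      · intro a ha b hb hab
        rcases Finset.mem_insert.mp ha with rfl | ha' <;>
          rcases Finset.mem_insert.mp hb with rfl | hb'
        · exact absurd rfl hab
        · exact hfar b hb'
        · rw [dist_comm]; exact hfar a ha'
        · exact hA a ha' b hb' hab
  obtain ⟨A, hAn, hAT, hA⟩ := hgrow (htf.toFinset.card + 1)
  have := hcard A hAT hA
  omega

/-- The number of `s`-separated points in a ball of radius `5 * s` is bounded independently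
of `s`. -/
theorem exists_packing_bound (E : Type*) [NormedAddCommGroup E] [NormedSpace ℂ E]
    [FiniteDimensional ℂ E] :
    ∃ m : ℕ, 0 < m ∧ ∀ s : ℝ, 0 < s → ∀ (u : E) (c : ℕ → E), (∀ i < m, dist u (c i) < 5 * s) →
      ∃ i j, i < j ∧ j < m ∧ dist (c i) (c j) < s := by
  have : ProperSpace E := FiniteDimensional.proper ℂ E
  obtain ⟨t, htf, ht⟩ := Metric.totallyBounded_iff.mp
    (isCompact_closedBall (0 : E) 5).totallyBounded (1 / 2) (by norm_num)
  refine ⟨htf.toFinset.card + 1, by omega, fun s hs u c hc => ?_⟩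
  set d : ℕ → E := fun i => (s⁻¹ : ℂ) • (c i - u) with hd
  have hnorm : ‖(s⁻¹ : ℂ)‖ = s⁻¹ := by
    rw [norm_inv, Complex.norm_real, Real.norm_of_nonneg hs.le]
  have hcov : ∀ i ∈ Finset.range (htf.toFinset.card + 1), ∃ y ∈ t, dist (d i) y < 1 / 2 := by
    intro i hi
    have h1 : d i ∈ Metric.closedBall (0 : E) 5 := by
      rw [mem_closedBall_zero_iff, hd, norm_smul, hnorm, ← dist_eq_norm, dist_comm,
        inv_mul_le_iff₀ hs, mul_comm]
      exact (hc i (Finset.mem_range.mp hi)).le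
    simpa using ht h1
  choose! y hyt hy using hcov
  obtain ⟨i, hi, j, hj, hij, hyij⟩ := Finset.exists_ne_map_eq_of_card_lt_of_maps_to
    (s := Finset.range (htf.toFinset.card + 1)) (t := htf.toFinset) (by simp)
    (f := y) (fun i hi => by simpa using hyt i hi)
  have hclose : dist (c i) (c j) < s := by
    have h1 : dist (d i) (d j) < 1 := by
      have h2 := dist_triangle_right (d i) (d j) (y i)
      have h3 := hy i hi
      have h4 := hy j hj
      rw [← hyij] at h4
      linarith
    rwa [hd, dist_smul₀, hnorm, dist_sub_right, inv_mul_lt_iff₀ hs, mul_one] at h1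
  rw [Finset.mem_range] at hi hj
  rcases lt_or_gt_of_ne hij with h | h
  · exact ⟨i, j, h, hj, hclose⟩
  · exact ⟨j, i, h, hi, by rwa [dist_comm]⟩

/-- At every scale `s` the unit sphere is covered by `s`-balls around boundedly many
`5 * s`-separated sets of unit vectors. -/
theorem exists_separated_covering_families (E : Type*) [NormedAddCommGroup E] [NormedSpace ℂ E]
    [FiniteDimensional ℂ E] :
    ∃ m : ℕ, 0 < m ∧ ∀ s : ℝ, 0 < s → ∃ A : ℕ → Finset E, (∀ i, ∀ a ∈ A i, ‖a‖ = 1) ∧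
      (∀ i, ∀ a ∈ A i, ∀ b ∈ A i, a ≠ b → 5 * s ≤ dist a b) ∧
      ∀ u : E, ‖u‖ = 1 → ∃ i < m, ∃ a ∈ A i, dist u a < s := by
  classical
  have : ProperSpace E := FiniteDimensional.proper ℂ E
  obtain ⟨m, hm0, hm⟩ := exists_packing_bound E
  refine ⟨m, hm0, fun s hs => ?_⟩
  -- Greedy choice: each family is maximal among the unit vectors not yet within `s` of the earlier
  -- families `P`.
  have hex : ∀ P : Finset E, ∃ A : Finset E, (∀ a ∈ A, ‖a‖ = 1 ∧ ∀ b ∈ P, s ≤ dist a b) ∧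
      (∀ a ∈ A, ∀ b ∈ A, a ≠ b → 5 * s ≤ dist a b) ∧
      ∀ u, ‖u‖ = 1 ∧ (∀ b ∈ P, s ≤ dist u b) → ∃ a ∈ A, dist u a < 5 * s := fun P =>
    TotallyBounded.exists_finset_maximal_separated
      (T := {u : E | ‖u‖ = 1 ∧ ∀ b ∈ P, s ≤ dist u b})
      ((isCompact_sphere (0 : E) 1).totallyBounded.subset fun u hu => by simpa using hu.1)
      (by linarith)
  choose F hF hFsep hFmax using hex
  let P : ℕ → Finset E := Nat.rec ∅ fun _ Q => Q ∪ F Q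
  have hP : ∀ i b, b ∈ P i ↔ ∃ j < i, b ∈ F (P j) := by
    intro i b
    induction i with
    | zero => simp [P]
    | succ i ih =>
      rw [show P (i + 1) = P i ∪ F (P i) from rfl, Finset.mem_union, ih, Nat.exists_lt_succ_right]
  refine ⟨fun i => F (P i), fun i a ha => (hF _ a ha).1, fun i => hFsep _, fun u hu => ?_⟩
  -- By maximality, a missed `u` is within `5 * s` of all `m` families, giving `m` points pairwise
  -- at least `s` apart, against the packing bound.
  by_contra! hfar
  have hc : ∀ i < m, ∃ a ∈ F (P i), dist u a < 5 * s := fun i hi =>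
    hFmax _ u ⟨hu, fun b hb => by
      obtain ⟨j, hj, hbj⟩ := (hP i b).mp hb
      exact hfar j (hj.trans hi) b hbj⟩
  choose! c hcF hcu using hc
  obtain ⟨i, j, hij, hj, hlt⟩ := hm s hs u c hcu
  have := (hF _ _ (hcF j hj)).2 (c i) ((hP j _).mpr ⟨i, hij, hcF i (hij.trans hj)⟩)
  rw [dist_comm] at this
  linarith

/-! ### Lengths of paths. -/

/-- A path of finite length to the unit sphere crosses an increasing sequence of spheres in
succession. -/
theorem IsFiniteLengthPathToSphere.exists_crossings {E : Type*} [NormedAddCommGroup E]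
    {p : ℝ → E} (hp : IsFiniteLengthPathToSphere p) {ρ : ℕ → ℝ} (hmono : Monotone ρ)
    (hρ : ∀ n, ρ n < 1) (h0 : ‖p 0‖ ≤ ρ 0) :
    ∃ x : ℕ → E, (∀ n, ∃ t ∈ Set.Ico (0 : ℝ) 1, p t = x n) ∧ (∀ n, ‖x n‖ = ρ n) ∧
      ∃ C : ℝ, ∀ n, ∑ i ∈ Finset.range n, dist (x i) (x (i + 1)) ≤ C := by
  have hivt : ∀ t r : ℝ, t ∈ Set.Ico (0 : ℝ) 1 ∧ ‖p t‖ ≤ r ∧ r < 1 →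
      ∃ t' ∈ Set.Ico t 1, ‖p t'‖ = r := by
    rintro t r ⟨ht, hpt, hr⟩
    have hcont : ContinuousOn (fun t => ‖p t‖) (Set.Icc t 1) :=
      (hp.continuousOn.mono (Set.Icc_subset_Icc_left ht.1)).norm
    obtain ⟨t', ht', he⟩ := intermediate_value_Icc ht.2.le hcont
      ⟨hpt, by rw [hp.norm_end]; exact hr.le⟩
    refine ⟨t', ⟨ht'.1, lt_of_le_of_ne ht'.2 ?_⟩, he⟩
    rintro rfl
    have := hp.norm_end
    simp only at he
    linarith
  choose! next hnext hnorm using hivt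
  let t : ℕ → ℝ := Nat.rec (next 0 (ρ 0)) fun n s => next s (ρ (n + 1))
  have h00 : (0 : ℝ) ∈ Set.Ico (0 : ℝ) 1 ∧ ‖p 0‖ ≤ ρ 0 ∧ ρ 0 < 1 := ⟨by simp, h0, hρ 0⟩
  have ht : ∀ n, t n ∈ Set.Ico (0 : ℝ) 1 ∧ ‖p (t n)‖ = ρ n := by
    intro n
    induction n with
    | zero => exact ⟨hnext _ _ h00, hnorm _ _ h00⟩
    | succ n ih =>
      have hn : t n ∈ Set.Ico (0 : ℝ) 1 ∧ ‖p (t n)‖ ≤ ρ (n + 1) ∧ ρ (n + 1) < 1 :=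
        ⟨ih.1, ih.2.trans_le (hmono n.le_succ), hρ _⟩
      exact ⟨⟨ih.1.1.trans (hnext _ _ hn).1, (hnext _ _ hn).2⟩, hnorm _ _ hn⟩
  have htmono : Monotone t := monotone_nat_of_le_succ fun n =>
    (hnext (t n) (ρ (n + 1))
      ⟨(ht n).1, (ht n).2.trans_le (hmono n.le_succ), hρ _⟩).1
  refine ⟨fun n => p (t n), fun n => ⟨t n, (ht n).1, rfl⟩, fun n => (ht n).2,
    (eVariationOn p (Set.Icc 0 1)).toReal, fun n => ?_⟩
  have h := eVariationOn.sum_le (f := p) (n := n) htmono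
    fun i => Set.Ico_subset_Icc_self (ht i).1
  have h2 := ENNReal.toReal_mono hp.length_ne_top h
  rw [ENNReal.toReal_sum fun i _ => edist_ne_top _ _] at h2
  simpa only [← dist_edist, dist_comm] using h2

/-- Radial projection to the unit sphere is Lipschitz away from the origin. -/
theorem dist_inv_norm_smul_le {E : Type*} [NormedAddCommGroup E] [NormedSpace ℂ E] {x y : E}
    (hx : 1 / 2 ≤ ‖x‖) (hy : 1 / 2 ≤ ‖y‖) :
    dist ((‖x‖⁻¹ : ℂ) • x) ((‖y‖⁻¹ : ℂ) • y) ≤ 4 * dist x y := by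
  have hx0 : 0 < ‖x‖ := by linarith
  have hy0 : 0 < ‖y‖ := by linarith
  have hxn : ‖(‖x‖⁻¹ : ℂ)‖ = ‖x‖⁻¹ := by simp
  have h1 : dist ((‖x‖⁻¹ : ℂ) • x) ((‖x‖⁻¹ : ℂ) • y) = ‖x‖⁻¹ * dist x y := by
    rw [dist_smul₀, hxn]
  have h2 : dist ((‖x‖⁻¹ : ℂ) • y) ((‖y‖⁻¹ : ℂ) • y) ≤ ‖x‖⁻¹ * dist x y := by
    rw [dist_eq_norm, ← sub_smul, norm_smul]
    have h3 : ‖(‖x‖⁻¹ : ℂ) - (‖y‖⁻¹ : ℂ)‖ = |‖x‖⁻¹ - ‖y‖⁻¹| := by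
      rw [← Real.norm_eq_abs, ← Complex.norm_real]; push_cast; rfl
    have h4 : ‖x‖⁻¹ - ‖y‖⁻¹ = ‖x‖⁻¹ * ‖y‖⁻¹ * (‖y‖ - ‖x‖) := by field_simp
    rw [h3, h4, abs_mul, abs_of_pos (by positivity)]
    have h5 : |‖y‖ - ‖x‖| ≤ dist x y := by
      rw [dist_comm, dist_eq_norm]; exact abs_norm_sub_norm_le y x
    calc ‖x‖⁻¹ * ‖y‖⁻¹ * |‖y‖ - ‖x‖| * ‖y‖ = ‖x‖⁻¹ * |‖y‖ - ‖x‖| := by field_simp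
      _ ≤ _ := by gcongr
  have h6 : ‖x‖⁻¹ ≤ 2 := by
    rw [inv_le_comm₀ hx0 (by norm_num)]; linarith
  have h7 := dist_triangle ((‖x‖⁻¹ : ℂ) • x) ((‖x‖⁻¹ : ℂ) • y) ((‖y‖⁻¹ : ℂ) • y)
  nlinarith [dist_nonneg (x := x) (y := y)]

/-- If a sequence of points moves by at least `c / (k + 1)` within the `k`-th block of `m`
successive steps, then its length is infinite. -/
theorem not_bounded_length_of_harmonic_blocks {X : Type*} [PseudoMetricSpace X] {x : ℕ → X}
    {m b₀ : ℕ} {c : ℝ} (hc : 0 < c)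
    (h : ∀ b, ∃ i ≤ m, c / ((b₀ + b : ℕ) + 1) ≤ dist (x (m * b)) (x (m * b + i))) (C : ℝ) :
    ∃ n, C < ∑ i ∈ Finset.range n, dist (x i) (x (i + 1)) := by
  by_contra! hC
  have hblock : ∀ n, ∑ b ∈ Finset.range n, c / ((b₀ + b : ℕ) + 1 : ℝ) ≤
      ∑ i ∈ Finset.range (m * n), dist (x i) (x (i + 1)) := by
    intro n
    induction n with
    | zero => simp
    | succ n ih =>
      obtain ⟨i, hi, hdist⟩ := h n
      have h1 := hdist.trans (dist_le_Ico_sum_dist x (Nat.le_add_right (m * n) i))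
      rw [Finset.sum_Ico_eq_sub _ (Nat.le_add_right _ _)] at h1
      have h2 : ∑ k ∈ Finset.range (m * n + i), dist (x k) (x (k + 1)) ≤
          ∑ k ∈ Finset.range (m * (n + 1)), dist (x k) (x (k + 1)) :=
        Finset.sum_le_sum_of_subset_of_nonneg
          (Finset.range_mono (by rw [mul_add_one]; omega)) fun _ _ _ => dist_nonneg
      rw [Finset.sum_range_succ]
      linarith
  have hsum : Summable fun b : ℕ => c / ((b₀ + b : ℕ) + 1 : ℝ) :=
    summable_of_sum_range_le (fun b => by positivity) fun n => (hblock n).trans (hC _)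
  refine Real.not_summable_one_div_natCast ((summable_nat_add_iff (b₀ + 1)).mp ?_)
  refine (hsum.mul_left c⁻¹).congr fun b => ?_
  push_cast
  field_simp
  ring

/-! ### Assembly. -/

theorem theorem1p1 (N : ℕ) (hN : 2 ≤ N) :
    ∃ f : EuclideanSpace ℂ (Fin N) → ℂ,
      DifferentiableOn ℂ f (Metric.ball 0 1) ∧
      ∀ p : ℝ → EuclideanSpace ℂ (Fin N), IsFiniteLengthPathToSphere p →
        ¬ Bornology.IsBounded ((fun t : ℝ => (f (p t)).re) '' Set.Ico 0 1) := by
  obtain ⟨m, hm0, hm⟩ := exists_separated_covering_families (EuclideanSpace ℂ (Fin N))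
  let s : ℕ → ℝ := fun b => 1 / (3 * (m + 1)) / (b + 1)
  have hs : ∀ b, 0 < s b := fun b => by positivity
  choose A hA1 hAsep hAcov using fun b => hm (s b) (hs b)
  let ρ : ℕ → ℝ := fun k => 1 - 1 / 2 / (k + 1)
  -- The gap is `1 / 2 / ((k + 1) * (k + 2))`; the factor `m + 1` in `s` gives `k + 2 ≤ (m + 1) * (k
  -- / m + 1)`.
  have hgap : ∀ k, ρ k + 3 * s (k / m) ^ 2 ≤ ρ (k + 1) := by
    intro k
    have hk : ((k : ℝ) + 1 + 1) ≤ (m + 1) * ((k / m : ℕ) + 1) := by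
      have h1 := Nat.div_add_mod k m
      have h2 := Nat.mod_lt k hm0
      have h3 : k + 1 + 1 ≤ (m + 1) * (k / m + 1) := by nlinarith [Nat.zero_le (k / m)]
      exact_mod_cast h3
    have h4 : ρ (k + 1) - ρ k = 1 / 2 / ((k + 1) * (k + 1 + 1)) := by
      simp only [ρ]; push_cast; field_simp; ring
    have h5 : 3 * s (k / m) ^ 2 = 1 / 3 / ((m + 1) * ((k / m : ℕ) + 1)) ^ 2 := by
      simp only [s]; field_simp
    have h6 : (1 : ℝ) / 3 / ((m + 1) * ((k / m : ℕ) + 1)) ^ 2 ≤ 1 / 2 / ((k + 1) * (k + 1 + 1)) := by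
      have : ((k : ℝ) + 1) * (k + 1 + 1) ≤ ((m + 1) * ((k / m : ℕ) + 1)) ^ 2 := by
        rw [sq]; apply mul_le_mul <;> first | positivity | linarith
      apply div_le_div₀ <;> first | positivity | linarith
    linarith
  have hmono : Monotone ρ := monotone_nat_of_le_succ fun k => by
    nlinarith [hgap k, sq_nonneg (s (k / m))]
  have hρhalf : ∀ k, 1 / 2 ≤ ρ k := fun k => by
    have h := hmono (Nat.zero_le k)
    simp only [ρ] at h ⊢
    norm_num at h ⊢
    linarith
  have hρ1 : ∀ k, ρ k < 1 := fun k => sub_lt_self _ (by positivity)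
  have hlim : Filter.Tendsto ρ Filter.atTop (nhds 1) := by
    have h := (tendsto_one_div_add_atTop_nhds_zero_nat (𝕜 := ℝ)).const_mul (1 / 2)
    have h' := h.const_sub 1
    simp only [mul_zero, sub_zero] at h'
    refine h'.congr fun k => ?_
    simp only [ρ]
    ring
  -- `k / m` is the block, which fixes the scale; `k % m` is the family within it.
  let B : ℕ → Set (EuclideanSpace ℂ (Fin N)) := fun k => {z | ∃ u, ‖u‖ = 1 ∧
    (∃ a ∈ A (k / m) (k % m), dist u a ≤ 2 * s (k / m)) ∧ z = (ρ (k + 1) : ℂ) • u}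
  obtain ⟨f, hf, hfB⟩ := exists_differentiableOn_ball_re_ge hmono hlim (B := B)
    (by
      rintro k _ ⟨u, hu, -, rfl⟩
      rw [norm_smul, hu, mul_one, Complex.norm_real,
        Real.norm_of_nonneg (by linarith [hρhalf (k + 1)])])
    (by
      intro k ε hε M
      obtain ⟨g, hg, hgs, hgl⟩ := exists_entire_small_on_ball_large_on_caps (hs (k / m))
        (hA1 _ (k % m)) (hAsep _ (k % m)) (by linarith [hρhalf k]) (hρ1 (k + 1)).le (hgap k) hε M
      exact ⟨g, hg, hgs, by rintro _ ⟨u, hu, hau, rfl⟩; exact hgl u hu hau⟩)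
  refine ⟨f, hf, fun p hp hbdd => ?_⟩
  obtain ⟨M, hM⟩ := hbdd.exists_norm_le
  obtain ⟨b₀, hb₀ρ, hb₀M⟩ : ∃ b₀ : ℕ, ‖p 0‖ < ρ b₀ ∧ M < b₀ :=
    ((hlim.eventually_const_lt (hp.norm_lt_one 0 (by simp))).and
      (tendsto_natCast_atTop_atTop.eventually_gt_atTop M)).exists
  have hle : b₀ ≤ m * b₀ := Nat.le_mul_of_pos_left _ hm0
  obtain ⟨x, hxp, hxρ, C, hC⟩ := hp.exists_crossings (ρ := fun n => ρ (m * b₀ + n))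
    (fun i j hij => hmono (by omega)) (fun n => hρ1 _) (hb₀ρ.le.trans (hmono hle))
  have hxB : ∀ n k, b₀ ≤ k → x n ∉ B k := by
    intro n k hk hmem
    obtain ⟨t, ht, htx⟩ := hxp n
    have h1 := hfB k _ hmem
    have h2 := (abs_le.mp (hM _ ⟨t, ht, rfl⟩)).2
    simp only [htx] at h2
    have h3 : (b₀ : ℝ) ≤ k := by exact_mod_cast hk
    linarith
  have hxhalf : ∀ n, 1 / 2 ≤ ‖x n‖ := fun n => (hρhalf _).trans_eq (hxρ n).symm
  have hunit : ∀ n, ‖(‖x n‖⁻¹ : ℂ) • x n‖ = 1 := fun n => by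
    rw [norm_smul, norm_inv, Complex.norm_real, norm_norm,
      inv_mul_cancel₀ (by linarith [hxhalf n])]
  obtain ⟨n, hn⟩ := not_bounded_length_of_harmonic_blocks (x := x) (m := m) (b₀ := b₀)
    (c := 1 / (3 * (m + 1)) / 4) (by positivity) (fun b => by
      obtain ⟨i, him, a, ha, hua⟩ := hAcov (b₀ + b) _ (hunit (m * b))
      -- `B k` lies on the sphere of radius `ρ (k + 1)`, so family `i` is met one crossing later.
      refine ⟨i + 1, him, ?_⟩
      have hdiv : (m * (b₀ + b) + i) / m = b₀ + b := by
        rw [Nat.mul_add_div hm0, Nat.div_eq_of_lt him, add_zero]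
      have hmod : (m * (b₀ + b) + i) % m = i := by
        rw [Nat.mul_add_mod, Nat.mod_eq_of_lt him]
      have hfar : 2 * s (b₀ + b) < dist ((‖x (m * b + (i + 1))‖⁻¹ : ℂ) • x (m * b + (i + 1))) a := by
        by_contra! hle'
        refine hxB (m * b + (i + 1)) (m * (b₀ + b) + i) (by nlinarith)
          ⟨_, hunit _, ⟨a, by rwa [hdiv, hmod], by rwa [hdiv]⟩, ?_⟩
        have hρeq : ρ (m * (b₀ + b) + i + 1) = ‖x (m * b + (i + 1))‖ := by
          rw [hxρ]; congr 1; ring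
        rw [hρeq, smul_smul, mul_inv_cancel₀, one_smul]
        exact_mod_cast (by linarith [hxhalf (m * b + (i + 1))] : ‖x (m * b + (i + 1))‖ ≠ 0)
      have h1 := dist_inv_norm_smul_le (hxhalf (m * b)) (hxhalf (m * b + (i + 1)))
      have h2 := dist_triangle_left ((‖x (m * b + (i + 1))‖⁻¹ : ℂ) • x (m * b + (i + 1))) a
        ((‖x (m * b)‖⁻¹ : ℂ) • x (m * b))
      have h3 : 1 / (3 * (m + 1)) / 4 / (((b₀ + b : ℕ) : ℝ) + 1) = s (b₀ + b) / 4 := by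
        simp only [s]; ring
      rw [h3]
      linarith) C
  exact hn.not_ge (hC n)
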